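/- Let $M$ be a smooth (Hausdorff, paracompact) manifold without boundary, let $\mathcal F$ be either a smooth foliation of $M$ of codimension $q$ (put $K=\mathbb R$) or a transversely holomorphic foliation of $M$ of complex codimension $q$ (put $K=\mathbb C$), and let $y^1,\dots,y^q$ denote the ($K$-valued) transverse coordinates of foliation charts. Let $E(\mathcal F)\subset TM\otimes K$ be the common kernel of the local forms $dy^1,\dots,dy^q$, let $\pi\colon TM\otimes K\to Q(\mathcal F)=(TM\otimes K)/E(\mathcal F)$ be the normal bundle, and let $K_{\mathcal F}^{-1}=\bigwedge^q Q(\mathcal F)$. Let $C^r_{\mathcal F}=\Omega^r(M;Q(\mathcal F))/I^r_1(M;Q(\mathcal F))$, where $\Omega^r(M;Q(\mathcal F))$ is the space of smooth $Q(\mathcal F)$-valued $r$-forms and $I_1^r$ consists of those locally generated by $dy^1,\dots,dy^q$, that is, of those whose restriction to $E(\mathcal F)$ vanishes. Let $\nabla^b$ be a Bott connection on $Q(\mathcal F)$, i.e. $\nabla^b_X\pi(Y)=\pi[X,Y]$ for sections $X$ of $E(\mathcal F)$ and $Y$ of $TM\otimes K$, and let $d_{\mathcal F}\colon C^r_{\mathcal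 F}\to C^{r+1}_{\mathcal F}$ be the map induced by the covariant exterior derivative of $\nabla^b$ (it does not depend on $\nabla^b$). Write $H^r(M;\Theta_{\mathcal F})$ for the $r$-th cohomology of $(C^*_{\mathcal F},d_{\mathcal F})$, $r\ge 0$; this complex resolves the sheaf of germs of vector fields preserving $\mathcal F$, taken modulo $E(\mathcal F)$. A Bott connection on $K_{\mathcal F}^{-1}$ is a connection $\mathcal D$ with $\mathcal D_X=L_X$ (the Lie derivative) for sections $X$ of $E(\mathcal F)$. For a trivialization (nowhere vanishing smooth section) $e$ of $K_{\mathcal F}^{-1}$, let $\theta^e$ be the connection form of $\mathcal D$ with respect to $e$, i.e. the one-form with $\mathcal D_X e=\theta^e(X)\,e$. **Lemma.** For every trivialization $e$ of $K_{\mathcal F}^{-1}$, every Bott connection $\mathcal D$ on $K_{\mathcal F}^{-1}$ and every $r\ge 0$, $\theta^e\wedge c$ is $d_{\mathcal F}$-closed whenever $c\in C^r_{\mathcal F}$ is, and there is a unique, well-defined $K$-linear map $$\theta^e\wedge\colon H^r(M;\Theta_{\mathcal F})\to H^{r+1}(M;\Theta_{\mathcal F}),\qquad [c]\mapsto[\theta^e\wedge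 c].$$ This map depends only on the homotopy class of the trivialization $e$ (homotopies through continuous nowhere vanishing sections) and not on $\mathcal D$: if $e,e'$ are homotopic trivializations and $\mathcal D,\mathcal D'$ are Bott connections on $K_{\mathcal F}^{-1}$, then the maps defined by $(e,\mathcal D)$ and by $(e',\mathcal D')$ are equal. -/

import Mathlib

open scoped Manifold ContDiff

set_option linter.unusedSectionVars false

/-! ### Vector fields, connections, differential forms

Throughout, `A` is the algebra of smooth `K`-valued functions on a (Hausdorff, paracompact) smooth
manifold `M`, and a vector bundle is handled through its `A`-module of global smooth sections.
The sections of `TM ⊗ K` are the `K`-linear derivations of `A`, with the commutator bracket. -/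

/-- The smooth sections of `TM ⊗ K`. -/
abbrev VField (K A : Type*) [CommRing K] [CommRing A] [Algebra K A] : Type _ := Derivation K A A

/-- A connection (covariant derivative) on the bundle with module of sections `N`. -/
structure Connection (K A N : Type*) [Field K] [CommRing A] [Algebra K A]
    [AddCommGroup N] [Module A N] [Module K N] [IsScalarTower K A N] where
  /-- `D X s` is the covariant derivative of `s` in the direction `X`. -/
  D : VField K A → N → N
  add_left : ∀ X Y s, D (X + Y) s = D X s + D Y s
  smul_left : ∀ (a : A) X s, D (a • X) s = a • D X s
  add_right : ∀ X s t, D X (s + t) = D X s + D X t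
  leibniz : ∀ X (a : A) s, D X (a • s) = X a • s + a • D X s

/-- The smooth `r`-forms with values in the bundle with module of sections `N`: alternating
`A`-multilinear maps on vector fields. -/
abbrev DForm (K A N : Type*) [Field K] [CommRing A] [Algebra K A]
    [AddCommGroup N] [Module A N] (r : ℕ) : Type _ :=
  (VField K A) [⋀^Fin r]→ₗ[A] N

/-- The smooth scalar (`K`-valued) one-forms. -/
abbrev OneForm (K A : Type*) [Field K] [CommRing A] [Algebra K A] : Type _ :=
  (VField K A) →ₗ[A] A

section Algebra

variable {K A N : Type*} [Field K] [CommRing A] [Algebra K A]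
  [AddCommGroup N] [Module A N] [Module K N] [IsScalarTower K A N]

/-- The wedge product of a scalar one-form `θ` and an `N`-valued `r`-form `c`:
`(θ ∧ c)(X₀, …, X_r) = ∑ i, (-1)^i θ(X_i) c(X₀, …, X̂_i, …, X_r)`. -/
def wedgeOne {r : ℕ} (θ : OneForm K A) (c : DForm K A N r) : DForm K A N (r + 1) :=
  AlternatingMap.alternatizeUncurryFin (θ.smulRight c)

theorem wedgeOne_apply {r : ℕ} (θ : OneForm K A) (c : DForm K A N r)
    (X : Fin (r + 1) → VField K A) :
    wedgeOne θ c X = ∑ i : Fin (r + 1), (-1) ^ (i : ℕ) • (θ (X i) • c (i.removeNth X)) := by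
  simp [wedgeOne, AlternatingMap.alternatizeUncurryFin_apply]

/-- `θ ∧ ·` as a `K`-linear map. -/
def wedgeOneL (N : Type*) [AddCommGroup N] [Module A N] [Module K N] [IsScalarTower K A N]
    (r : ℕ) (θ : OneForm K A) : DForm K A N r →ₗ[K] DForm K A N (r + 1) where
  toFun := wedgeOne θ
  map_add' c c' := by
    ext X
    simp [wedgeOne_apply, Finset.sum_add_distrib]
  map_smul' k c := by
    ext X
    simp only [wedgeOne_apply, AlternatingMap.smul_apply, RingHom.id_apply, Finset.smul_sum]
    refine Finset.sum_congr rfl fun i _ => ?_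
    rw [smul_comm k, smul_comm k (θ (X i))]

theorem Connection.smul_right_base (nab : Connection K A N) (X : VField K A) (k : K) (s : N) :
    nab.D X (k • s) = k • nab.D X s := by
  rw [← algebraMap_smul A k s, nab.leibniz]
  simp

/-- The Koszul formula for the covariant exterior derivative `d^∇ c` of an `r`-form `c`:
`∑ i, (-1)^i ∇_{X_i} (c (X₀, …, X̂_i, …, X_r))
  - ∑ i < l, (-1)^i c (X₀, …, X̂_i, …, [X_i, X_l], …, X_r)`,
where `[X_i, X_l]` stands in the place of `X_l`; a pair `i < l` of indices is written as
`(i.castSucc, j.succ)` with `i ≤ j`. For `N = A` with the flat connection `∇_X f = X f` this is the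
exterior derivative, and for `c = ∑ e_i ⊗ c^i` in a local frame with connection form `τ` it is
`∑ e_i ⊗ (d c^i + ∑ τ^i_j ∧ c^j)`. -/
def koszul {r : ℕ} (nab : Connection K A N) (c : DForm K A N r) (X : Fin (r + 1) → VField K A) :
    N :=
  (∑ i : Fin (r + 1), (-1) ^ (i : ℕ) • nab.D (X i) (c (i.removeNth X)))
    - ∑ i : Fin r, ∑ j ≥ i, (-1) ^ (i : ℕ) •
        c (Function.update (i.castSucc.removeNth X) j ⁅X i.castSucc, X j.succ⁆)

theorem update_removeNth_eq {r : ℕ} (c : DForm K A N (r + 1)) (v : Fin (r + 1) → VField K A)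
    (k : Fin (r + 1)) (Y : VField K A) :
    c (Function.update v k Y) = (-1) ^ (k : ℕ) • c (Matrix.vecCons Y (k.removeNth v)) := by
  rw [← AlternatingMap.map_insertNth, Fin.insertNth_removeNth]

/-- Summing over all ordered pairs of indices counts every bracket term twice. -/
theorem sum_bracket_all {r : ℕ} (c : DForm K A N r) (X : Fin (r + 1) → VField K A) :
    ∑ i : Fin (r + 1), ∑ k : Fin r, (-1) ^ (i : ℕ) •
        c (Function.update (i.removeNth X) k ⁅X i, i.removeNth X k⁆) =
      2 • ∑ i : Fin r, ∑ j ≥ i, (-1) ^ (i : ℕ) •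
        c (Function.update (i.castSucc.removeNth X) j ⁅X i.castSucc, X j.succ⁆) := by
  cases r with
  | zero => simp
  | succ r =>
    rw [Fin.sum_sum_eq_sum_triangle_add, Finset.smul_sum]
    refine Fintype.sum_congr _ _ fun i => ?_
    rw [Finset.smul_sum]
    refine Finset.sum_congr rfl fun j hj => ?_
    rw [Finset.mem_Ici] at hj
    have H₁ : i.castSucc.removeNth X j = X j.succ := by
      simp [Fin.removeNth_apply, Fin.succAbove_of_le_castSucc, hj]
    have H₂ : j.succ.removeNth X i = X i.castSucc := by
      simp [Fin.removeNth_apply, Fin.succAbove_of_castSucc_lt, hj]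
    rw [H₁, H₂, update_removeNth_eq, update_removeNth_eq, two_smul]
    congr 1
    rw [← lie_skew, Fin.removeNth_removeNth_eq_swap]
    have h3 : Fin.predAbove i j.succ = j := by simp [Fin.predAbove, hj]
    have h4 : j.succ.succAbove i = i.castSucc := by simp [Fin.succAbove_of_castSucc_lt, hj]
    rw [h3, h4]
    have : ∀ (x : VField K A) (w : Fin r → VField K A),
        c (Matrix.vecCons (-x) w) = - c (Matrix.vecCons x w) := by
      intro x w
      have := c.map_update_neg (Matrix.vecCons x w) 0 x
      simpa [Matrix.vecCons] using this
    rw [this]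
    simp [pow_succ, smul_smul, mul_comm]

/-- The action of a linear endomorphism on alternating maps, as a derivation in the arguments. -/
def derivAct {V : Type*} [AddCommGroup V] [Module K V] {r : ℕ} (D : V →ₗ[K] V)
    (c : V [⋀^Fin r]→ₗ[K] N) : V [⋀^Fin r]→ₗ[K] N where
  toMultilinearMap := ∑ k : Fin r, c.toMultilinearMap.compLinearMap
    (fun j => if j = k then D else LinearMap.id)
  map_eq_zero_of_eq' := by
    intro v i j hv hij
    have key : ∀ k, (fun l => (if l = k then D else LinearMap.id : V →ₗ[K] V) (v l))
        = Function.update v k (D (v k)) := by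
      intro k
      ext l
      by_cases h : l = k
      · subst h; simp
      · simp [h]
    suffices ∑ k : Fin r, c (Function.update v k (D (v k))) = 0 by
      simpa [key] using this
    rw [Fintype.sum_eq_add i j hij]
    · rw [← hv]
      have : Function.update v j (D (v i)) =
          Function.update v i (D (v i)) ∘ Equiv.swap i j := by
        ext l
        by_cases h1 : l = i
        · subst h1; simp [Function.update_of_ne hij, Function.update_of_ne hij.symm, hv]
        · by_cases h2 : l = j
          · subst h2; simp
          · simp [Equiv.swap_apply_of_ne_of_ne h1 h2, h1, h2]
      rw [this, c.map_swap _ hij, add_neg_cancel]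
    · rintro k ⟨h1, h2⟩
      refine c.map_eq_zero_of_eq _ ?_ hij
      rw [Function.update_of_ne h1.symm, Function.update_of_ne h2.symm, hv]

theorem derivAct_apply {V : Type*} [AddCommGroup V] [Module K V] {r : ℕ} (D : V →ₗ[K] V)
    (c : V [⋀^Fin r]→ₗ[K] N) (v : Fin r → V) :
    derivAct D c v = ∑ k : Fin r, c (Function.update v k (D (v k))) := by
  have key : ∀ k, (fun l => (if l = k then D else LinearMap.id : V →ₗ[K] V) (v l))
      = Function.update v k (D (v k)) := by
    intro k
    ext l
    by_cases h : l = k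
    · subst h; simp
    · simp [h]
  change (∑ k : Fin r, c.toMultilinearMap.compLinearMap
    (fun j => if j = k then D else LinearMap.id)) v = _
  simp [key]

/-- The `A`-multilinear form `c`, regarded as `K`-multilinear. -/
def formBase {r : ℕ} (c : DForm K A N r) : (VField K A) [⋀^Fin r]→ₗ[K] N where
  toMultilinearMap := c.toMultilinearMap.restrictScalars K
  map_eq_zero_of_eq' := c.map_eq_zero_of_eq'

theorem formBase_apply {r : ℕ} (c : DForm K A N r) (X : Fin r → VField K A) :
    formBase c X = c X := rfl

/-- The covariant derivative along `X` as a `K`-linear map. -/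
def Connection.DL (nab : Connection K A N) (X : VField K A) : N →ₗ[K] N where
  toFun := nab.D X
  map_add' := nab.add_right X
  map_smul' := nab.smul_right_base X

theorem Connection.smul_left_base (nab : Connection K A N) (X : VField K A) (k : K) (s : N) :
    nab.D (k • X) s = k • nab.D X s := by
  rw [← algebraMap_smul A k X, nab.smul_left, algebraMap_smul]

/-- The map underlying the covariant exterior derivative, as a `K`-multilinear map. -/
def koszulBase [CharZero K] {r : ℕ} (nab : Connection K A N) (c : DForm K A N r) :
    (VField K A) [⋀^Fin (r + 1)]→ₗ[K] N :=
  AlternatingMap.alternatizeUncurryFin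
    { toFun := fun X => (nab.DL X).compAlternatingMap (formBase c)
      map_add' := by
        intro X Y
        ext v
        exact nab.add_left X Y _
      map_smul' := by
        intro k X
        ext v
        exact nab.smul_left_base X k _ }
  - (2 : K)⁻¹ • AlternatingMap.alternatizeUncurryFin
    { toFun := fun X => derivAct (LieModule.toEnd K (VField K A) (VField K A) X) (formBase c)
      map_add' := by
        intro X Y
        ext v
        simp [derivAct_apply, Finset.sum_add_distrib, AlternatingMap.map_update_add]
      map_smul' := by
        intro k X
        ext v
        simp [derivAct_apply, Finset.smul_sum, AlternatingMap.map_update_smul] }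

theorem koszulBase_apply' [CharZero K] {r : ℕ} (nab : Connection K A N) (c : DForm K A N r)
    (X : Fin (r + 1) → VField K A) :
    koszulBase nab c X =
      (∑ i : Fin (r + 1), (-1) ^ (i : ℕ) • nab.D (X i) (c (i.removeNth X)))
    - (2 : K)⁻¹ • ∑ i : Fin (r + 1), (-1) ^ (i : ℕ) • ∑ k : Fin r,
        c (Function.update (i.removeNth X) k ⁅X i, i.removeNth X k⁆) := by
  simp [koszulBase, AlternatingMap.alternatizeUncurryFin_apply, derivAct_apply, formBase_apply,
    Connection.DL]

theorem koszulBase_apply [CharZero K] {r : ℕ} (nab : Connection K A N) (c : DForm K A N r)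
    (X : Fin (r + 1) → VField K A) :
    koszulBase nab c X = koszul nab c X := by
  rw [koszulBase_apply', koszul]
  simp only [Finset.smul_sum (r := (-1 : ℤ) ^ _), sum_bracket_all]
  congr 1
  rw [← Nat.cast_smul_eq_nsmul K, smul_smul]
  simp

/-- An alternating map that is homogeneous in its first argument is homogeneous in all. -/
theorem smul_of_cons {r : ℕ} (g : (VField K A) [⋀^Fin (r + 1)]→ₗ[K] N)
    (hg : ∀ (a : A) x (v : Fin r → VField K A),
      g (Matrix.vecCons (a • x) v) = a • g (Matrix.vecCons x v))
    (v : Fin (r + 1) → VField K A) (k : Fin (r + 1)) (a : A) (x : VField K A) :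
    g (Function.update v k (a • x)) = a • g (Function.update v k x) := by
  rw [← Fin.insertNth_removeNth, ← Fin.insertNth_removeNth, AlternatingMap.map_insertNth,
    AlternatingMap.map_insertNth, hg, smul_comm]

theorem koszulBase_cons [CharZero K] {r : ℕ} (nab : Connection K A N) (c : DForm K A N r)
    (a : A) (x : VField K A) (v : Fin r → VField K A) :
    koszulBase nab c (Matrix.vecCons (a • x) v) =
      a • koszulBase nab c (Matrix.vecCons x v) := by
  have h1 : ∀ y : VField K A, ⁅y, a • x⁆ = a • ⁅y, x⁆ + y a • x := by
    intro y
    ext f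
    simp [Derivation.commutator_apply, mul_sub]
  have h2 : ∀ y : VField K A, ⁅a • x, y⁆ = a • ⁅x, y⁆ - y a • x := by
    intro y
    rw [← lie_skew, h1, ← lie_skew x y, smul_neg, neg_add, sub_eq_add_neg]
  have r0 : ∀ y : VField K A, (0 : Fin (r + 1)).removeNth (Matrix.vecCons y v) = v := by
    intro y; rfl
  cases r with
  | zero =>
    simp [koszulBase_apply', nab.smul_left, r0]
  | succ r =>
    have r1 : ∀ (y : VField K A) (i : Fin (r + 1)),
        i.succ.removeNth (Matrix.vecCons y v) = Matrix.vecCons y (i.removeNth v) := by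
      intro y i
      ext j : 1
      refine Fin.cases ?_ (fun j => ?_) j <;> simp [Fin.removeNth]
    have u0 : ∀ (y z : VField K A) (w : Fin r → VField K A),
        Function.update (Matrix.vecCons y w) 0 z = Matrix.vecCons z w := by
      intro y z w
      simp [Matrix.vecCons]
    have u1 : ∀ (y z : VField K A) (w : Fin r → VField K A) (k : Fin r),
        Function.update (Matrix.vecCons y w) k.succ z =
          Matrix.vecCons y (Function.update w k z) := by
      intro y z w k
      simp [Matrix.vecCons, Fin.cons_update]
    have cs : ∀ (b : A) (y : VField K A) (w : Fin r → VField K A),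
        c (Matrix.vecCons (b • y) w) = b • c (Matrix.vecCons y w) := by
      intro b y w
      simpa [u0] using c.map_update_smul (Matrix.vecCons y w) 0 b y
    have ca : ∀ (y z : VField K A) (w : Fin r → VField K A),
        c (Matrix.vecCons (y + z) w) = c (Matrix.vecCons y w) + c (Matrix.vecCons z w) := by
      intro y z w
      simpa [u0] using c.map_update_add (Matrix.vecCons y w) 0 y z
    have s1 : ∀ k : Fin (r + 1), c (Function.update v k x) =
        (-1) ^ (k : ℕ) • c (Matrix.vecCons x (k.removeNth v)) :=
      fun k => update_removeNth_eq c v k x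
    set P : N := ∑ i : Fin (r + 1), (-1) ^ (i : ℕ) • v i a • c (Matrix.vecCons x (i.removeNth v))
      with hP
    have e1 : (∑ i : Fin (r + 2), (-1) ^ (i : ℕ) • nab.D (Matrix.vecCons (a • x) v i)
          (c (i.removeNth (Matrix.vecCons (a • x) v)))) =
        a • (∑ i : Fin (r + 2), (-1) ^ (i : ℕ) • nab.D (Matrix.vecCons x v i)
          (c (i.removeNth (Matrix.vecCons x v)))) - P := by
      rw [Fin.sum_univ_succ, Fin.sum_univ_succ (f := fun i : Fin (r + 2) => (-1) ^ (i : ℕ) •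
        nab.D (Matrix.vecCons x v i) (c (i.removeNth (Matrix.vecCons x v))))]
      simp only [r0, r1, cs, Matrix.cons_val_zero, Matrix.cons_val_succ, nab.smul_left, nab.leibniz,
        smul_add, Finset.sum_add_distrib, Finset.smul_sum, hP, Fin.val_succ, pow_succ]
      simp only [mul_neg, mul_one, neg_smul, Finset.sum_neg_distrib, smul_comm a ((-1 : ℤ) ^ _),
        Fin.val_zero, pow_zero, one_smul, smul_neg]
      abel
    have e2 : (∑ i : Fin (r + 2), (-1) ^ (i : ℕ) • ∑ k : Fin (r + 1),
          c (Function.update (i.removeNth (Matrix.vecCons (a • x) v)) k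
            ⁅Matrix.vecCons (a • x) v i, i.removeNth (Matrix.vecCons (a • x) v) k⁆)) =
        a • (∑ i : Fin (r + 2), (-1) ^ (i : ℕ) • ∑ k : Fin (r + 1),
          c (Function.update (i.removeNth (Matrix.vecCons x v)) k
            ⁅Matrix.vecCons x v i, i.removeNth (Matrix.vecCons x v) k⁆)) - (2 : K) • P := by
      have t1 : ∑ k : Fin (r + 1), c (Function.update v k ⁅a • x, v k⁆) =
          a • ∑ k : Fin (r + 1), c (Function.update v k ⁅x, v k⁆) - P := by
        simp only [h2, AlternatingMap.map_update_sub, AlternatingMap.map_update_smul,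
          Finset.sum_sub_distrib, Finset.smul_sum, hP, s1]
        congr 1
        exact Finset.sum_congr rfl fun i _ => smul_comm _ _ _
      have t2 : ∀ i : Fin (r + 1), ∑ k : Fin (r + 1),
          c (Function.update (Matrix.vecCons (a • x) (i.removeNth v)) k
            ⁅v i, (Matrix.vecCons (a • x) (i.removeNth v) : Fin (r + 1) → VField K A) k⁆) =
          a • ∑ k : Fin (r + 1), c (Function.update (Matrix.vecCons x (i.removeNth v)) k
            ⁅v i, (Matrix.vecCons x (i.removeNth v) : Fin (r + 1) → VField K A) k⁆)
          + v i a • c (Matrix.vecCons x (i.removeNth v)) := by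
        intro i
        simp only [Fin.sum_univ_succ, Matrix.cons_val_zero, Matrix.cons_val_succ, u0, u1, h1, cs,
          ca, smul_add, Finset.smul_sum]
        abel
      rw [Fin.sum_univ_succ, Fin.sum_univ_succ (f := fun i : Fin (r + 2) => (-1) ^ (i : ℕ) •
        ∑ k : Fin (r + 1), c (Function.update (i.removeNth (Matrix.vecCons x v)) k
            ⁅Matrix.vecCons x v i, i.removeNth (Matrix.vecCons x v) k⁆))]
      simp only [r0, r1, Matrix.cons_val_zero, Matrix.cons_val_succ, t1, t2, two_smul]
      simp only [smul_add, Finset.sum_add_distrib, Fin.val_succ, pow_succ, mul_neg, mul_one,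
        neg_smul, Finset.sum_neg_distrib, Fin.val_zero, pow_zero, one_smul, smul_neg, ← hP]
      rw [Finset.smul_sum (r := a) (s := Finset.univ) (f := fun i : Fin (r + 1) => _ • _)]
      simp only [smul_comm a ((-1 : ℤ) ^ _)]
      abel
    rw [koszulBase_apply', koszulBase_apply', e1, e2]
    rw [smul_sub, smul_sub, smul_smul, inv_mul_cancel₀ two_ne_zero, one_smul, smul_comm a]
    abel

/-- The covariant exterior derivative `d^∇` on forms. -/
def extCovDeriv [CharZero K] {r : ℕ} (nab : Connection K A N) (c : DForm K A N r) :
    DForm K A N (r + 1) where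
  toFun := koszul nab c
  map_update_add' := by
    intro inst v i x y
    rw [Subsingleton.elim inst (instDecidableEqFin (r + 1))]
    simp only [← koszulBase_apply, AlternatingMap.map_update_add]
  map_update_smul' := by
    intro inst v i a x
    rw [Subsingleton.elim inst (instDecidableEqFin (r + 1))]
    simp only [← koszulBase_apply]
    exact smul_of_cons _ (koszulBase_cons nab c) v i a x
  map_eq_zero_of_eq' := by
    intro v i j hv hij
    simp only [← koszulBase_apply]
    exact (koszulBase nab c).map_eq_zero_of_eq v hv hij

theorem extCovDeriv_apply [CharZero K] {r : ℕ} (nab : Connection K A N) (c : DForm K A N r)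
    (X : Fin (r + 1) → VField K A) : extCovDeriv nab c X = koszul nab c X := rfl

/-- `d^∇` as a `K`-linear map `Ω^r → Ω^{r+1}`. -/
def extCovDerivL [CharZero K] (nab : Connection K A N) (r : ℕ) :
    DForm K A N r →ₗ[K] DForm K A N (r + 1) where
  toFun := extCovDeriv nab
  map_add' c c' := by
    ext X
    simp only [extCovDeriv_apply, koszul, AlternatingMap.add_apply, nab.add_right, smul_add,
      Finset.sum_add_distrib]
    abel
  map_smul' k c := by
    ext X
    simp only [extCovDeriv_apply, koszul, AlternatingMap.smul_apply, nab.smul_right_base,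
      RingHom.id_apply, smul_sub, Finset.smul_sum, smul_comm k ((-1 : ℤ) ^ _)]

end Algebra

/-! ### Smooth functions and foliations -/

section Geometry

variable {EM HM : Type*} [NormedAddCommGroup EM] [NormedSpace ℝ EM] [TopologicalSpace HM]

/-- The `K`-algebra of smooth (`C^∞` in the real sense) functions `M → K`. -/
def smoothFunctions (I : ModelWithCorners ℝ EM HM) (M : Type*) [TopologicalSpace M]
    [ChartedSpace HM M] (K : Type*) [RCLike K] : Subalgebra K (M → K) where
  carrier := {f | ContMDiff I 𝓘(ℝ, K) ∞ f}
  mul_mem' hf hg := (contDiff_mul (𝕜 := ℝ) (𝔸 := K)).contMDiff.comp (hf.prodMk_space hg)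
  add_mem' hf hg := hf.add hg
  algebraMap_mem' _ := contMDiff_const

/-- The type of smooth functions `M → K`, with its structure of a commutative `K`-algebra. -/
def SmoothFun (I : ModelWithCorners ℝ EM HM) (M : Type*) [TopologicalSpace M]
    [ChartedSpace HM M] (K : Type*) [RCLike K] : Type _ :=
  smoothFunctions I M K

namespace SmoothFun

variable {I : ModelWithCorners ℝ EM HM} {M : Type*} [TopologicalSpace M] [ChartedSpace HM M]
  {K : Type*} [RCLike K]

instance : CommRing (SmoothFun I M K) := inferInstanceAs (CommRing (smoothFunctions I M K))

instance : Algebra K (SmoothFun I M K) := inferInstanceAs (Algebra K (smoothFunctions I M K))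

instance : FunLike (SmoothFun I M K) M K where
  coe f := f.1
  coe_injective _ _ h := Subtype.ext h

theorem smooth (f : SmoothFun I M K) : ContMDiff I 𝓘(ℝ, K) ∞ f := f.2

@[simp] theorem add_apply (f g : SmoothFun I M K) (x : M) : (f + g) x = f x + g x := rfl

@[simp] theorem sub_apply (f g : SmoothFun I M K) (x : M) : (f - g) x = f x - g x := rfl

@[simp] theorem mul_apply (f g : SmoothFun I M K) (x : M) : (f * g) x = f x * g x := rfl

@[simp] theorem zero_apply (x : M) : (0 : SmoothFun I M K) x = 0 := rfl

@[simp] theorem smul_apply (k : K) (f : SmoothFun I M K) (x : M) : (k • f) x = k * f x := rfl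

end SmoothFun

/-- A smooth foliation of the manifold `M`, given by a foliation atlas. For `K = ℝ` this is a real
foliation of codimension `q`, with leaves of dimension `p`; for `K = ℂ` it is a transversely
holomorphic foliation of complex codimension `q`. The charts are diffeomorphisms onto products
`V × T` of an open connected set `V ⊆ ℝ^p` and an open ball `T ⊆ K^q`, the plaques being the sets
`V × {t}`; the transverse part of every change of charts is locally a function of the transverse
coordinates only, smooth over `K` (that is, holomorphic if `K = ℂ`). -/
structure Foliation (I : ModelWithCorners ℝ EM HM) (M : Type*) [TopologicalSpace M]
    [ChartedSpace HM M] (K : Type*) [RCLike K] (p q : ℕ) where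
  atlas : Set (OpenPartialHomeomorph M (EuclideanSpace ℝ (Fin p) × EuclideanSpace K (Fin q)))
  covers : ∀ x : M, ∃ φ ∈ atlas, x ∈ φ.source
  smooth : ∀ φ ∈ atlas,
    ContMDiffOn I 𝓘(ℝ, EuclideanSpace ℝ (Fin p) × EuclideanSpace K (Fin q)) ∞ φ φ.source
  smooth_symm : ∀ φ ∈ atlas,
    ContMDiffOn 𝓘(ℝ, EuclideanSpace ℝ (Fin p) × EuclideanSpace K (Fin q)) I ∞ φ.symm φ.target
  target_eq : ∀ φ ∈ atlas, ∃ (V : Set (EuclideanSpace ℝ (Fin p))) (t : EuclideanSpace K (Fin q))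
    (ρ : ℝ), IsOpen V ∧ IsConnected V ∧ 0 < ρ ∧ φ.target = V ×ˢ Metric.ball t ρ
  holonomy : ∀ φ ∈ atlas, ∀ ψ ∈ atlas, ∀ x ∈ φ.source ∩ ψ.source,
    ∃ γ : EuclideanSpace K (Fin q) → EuclideanSpace K (Fin q),
      ContDiffAt K ∞ γ (φ x).2 ∧ ∀ᶠ z in nhds x, (ψ z).2 = γ (φ z).2

namespace Foliation

variable {I : ModelWithCorners ℝ EM HM} {M : Type*} [TopologicalSpace M] [ChartedSpace HM M]
  {K : Type*} [RCLike K] {p q : ℕ}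

/-- The sections of `E(F)`: the vector fields `X` (sections of `TM ⊗ K`) that are annihilated by
the differentials `dy^1, …, dy^q` of the transverse coordinates of every foliation chart. For
`K = ℝ` this is `E(F) = TF`; for `K = ℂ` it is the complex bundle locally spanned by `TF` and the
`∂/∂ȳ^j`. As `y^i` is only defined on the chart domain, `dy^i(X)` at `x` is computed on global
smooth functions that agree with `y^i` near `x`. -/
def E (F : Foliation I M K p q) :
    Submodule (SmoothFun I M K) (VField K (SmoothFun I M K)) where
  carrier := {X | ∀ φ ∈ F.atlas, ∀ x ∈ φ.source, ∀ (i : Fin q) (f : SmoothFun I M K),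
    (∀ᶠ z in nhds x, f z = (φ z).2 i) → (X f) x = 0}
  add_mem' := by
    intro X Y hX hY φ hφ x hx i f hf
    simp [hX φ hφ x hx i f hf, hY φ hφ x hx i f hf]
  zero_mem' := by
    intro φ hφ x hx i f hf
    simp
  smul_mem' := by
    intro a X hX φ hφ x hx i f hf
    simp [hX φ hφ x hx i f hf]

/-- The (sections of the) normal bundle `Q(F) = (TM ⊗ K) / E(F)`. -/
abbrev Normal (F : Foliation I M K p q) : Type _ := VField K (SmoothFun I M K) ⧸ F.E

/-- The projection `π : TM ⊗ K → Q(F)` on sections. -/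
abbrev proj (F : Foliation I M K p q) :
    VField K (SmoothFun I M K) →ₗ[SmoothFun I M K] F.Normal := F.E.mkQ

/-- The (sections of the) anticanonical bundle `K_F^{-1} = ⋀^q Q(F)`. -/
abbrev Anticanonical (F : Foliation I M K p q) : Type _ := ⋀[SmoothFun I M K]^q F.Normal

/-- Bott connections on `Q(F)`: `∇_X (π Y) = π [X, Y]` for `X` in `E(F)`. -/
def IsBott (F : Foliation I M K p q) (nab : Connection K (SmoothFun I M K) F.Normal) :
    Prop :=
  ∀ X ∈ F.E, ∀ Y, nab.D X (F.proj Y) = F.proj ⁅X, Y⁆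

/-- Bott connections on `K_F^{-1}`: for `X` in `E(F)`, `D_X` is the Lie derivative, which is
`L_X (πY_1 ∧ … ∧ πY_q) = ∑ i, πY_1 ∧ … ∧ π[X, Y_i] ∧ … ∧ πY_q` on decomposable sections (these
generate all sections). -/
def IsBottAnticanonical (F : Foliation I M K p q)
    (D : Connection K (SmoothFun I M K) F.Anticanonical) : Prop :=
  ∀ X ∈ F.E, ∀ Y : Fin q → VField K (SmoothFun I M K),
    D.D X (exteriorPower.ιMulti (SmoothFun I M K) q fun j => F.proj (Y j)) =
      ∑ i : Fin q, exteriorPower.ιMulti (SmoothFun I M K) q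
        (Function.update (fun j => F.proj (Y j)) i (F.proj ⁅X, Y i⁆))

/-- A trivialization of the line bundle `K_F^{-1}`: a smooth section `e` such that every smooth
section is `a • e` for exactly one smooth function `a`, i.e. a nowhere vanishing section. -/
structure Trivialization (F : Foliation I M K p q) where
  sec : F.Anticanonical
  bijective : Function.Bijective (fun a : SmoothFun I M K => a • sec)

/-- The isomorphism `a ↦ a • e` given by a trivialization. -/
noncomputable def Trivialization.equiv {F : Foliation I M K p q} (e : F.Trivialization) :
    SmoothFun I M K ≃ₗ[SmoothFun I M K] F.Anticanonical :=
  LinearEquiv.ofBijective (LinearMap.toSpanSingleton _ _ e.sec) e.bijective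

/-- The trivializations `e` and `e'` are homotopic: there is a continuous path `e_t = h_t • e` of
(continuous) nowhere vanishing sections from `e` to `e'`. As `e` frames the line bundle `K_F^{-1}`,
every path of nowhere vanishing sections has this form, for a unique continuous function `h`
without zeros. -/
def Trivialization.Homotopic {F : Foliation I M K p q} (e e' : F.Trivialization) : Prop :=
  ∃ (h : unitInterval × M → K) (f : SmoothFun I M K),
    Continuous h ∧ (∀ s, h s ≠ 0) ∧ (∀ x, h (0, x) = 1) ∧ (∀ x, h (1, x) = f x) ∧
      e'.sec = f • e.sec

/-- The connection form `θ^e` of a connection on `K_F^{-1}` with respect to the trivialization `e`,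
characterized by `D_X e = θ^e(X) e`. -/
noncomputable def connectionForm (F : Foliation I M K p q) (e : F.Trivialization)
    (D : Connection K (SmoothFun I M K) F.Anticanonical) :
    OneForm K (SmoothFun I M K) :=
  e.equiv.symm.toLinearMap ∘ₗ
    { toFun := fun X => D.D X e.sec
      map_add' := fun X Y => D.add_left X Y e.sec
      map_smul' := fun a X => D.smul_left a X e.sec }

theorem connectionForm_smul (F : Foliation I M K p q) (e : F.Trivialization)
    (D : Connection K (SmoothFun I M K) F.Anticanonical)
    (X : VField K (SmoothFun I M K)) :
    F.connectionForm e D X • e.sec = D.D X e.sec :=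
  e.equiv.apply_symm_apply (D.D X e.sec)

/-- `I_1^r(M; Q(F))`: the `Q(F)`-valued `r`-forms in the ideal locally generated by
`dy^1, …, dy^q`, i.e. those whose restriction to `E(F)`, the common kernel of the `dy^i`,
vanishes. -/
def idealOne (F : Foliation I M K p q) (r : ℕ) :
    Submodule K (DForm K (SmoothFun I M K) F.Normal r) where
  carrier := {c | ∀ X, (∀ i, X i ∈ F.E) → c X = 0}
  add_mem' := by
    intro c c' h h' X hX
    simp [h X hX, h' X hX]
  zero_mem' := by
    intro X hX
    simp
  smul_mem' := by
    intro k c h X hX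
    simp [h X hX]

/-- `C_F^r(M; Q(F)) = Ω^r(M; Q(F)) / I_1^r(M; Q(F))`. -/
abbrev Cochain (F : Foliation I M K p q) (r : ℕ) : Type _ :=
  DForm K (SmoothFun I M K) F.Normal r ⧸ F.idealOne r

theorem wedge_idealOne (F : Foliation I M K p q) (r : ℕ)
    (θ : OneForm K (SmoothFun I M K)) :
    F.idealOne r ≤ (F.idealOne (r + 1)).comap (wedgeOneL F.Normal r θ) := by
  intro c hc X hX
  change wedgeOne θ c X = 0
  rw [wedgeOne_apply]
  refine Finset.sum_eq_zero fun i _ => ?_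
  rw [hc (i.removeNth X) fun j => hX _]
  simp

/-- `θ ∧ · : C_F^r(M; Q(F)) → C_F^{r+1}(M; Q(F))`, for a scalar one-form `θ`. -/
def wedge (F : Foliation I M K p q) (r : ℕ) (θ : OneForm K (SmoothFun I M K)) :
    F.Cochain r →ₗ[K] F.Cochain (r + 1) :=
  (F.idealOne r).mapQ (F.idealOne (r + 1)) (wedgeOneL F.Normal r θ) (F.wedge_idealOne r θ)

section Local

variable [FiniteDimensional ℝ EM] [IsManifold I ∞ M] [T2Space M]

/-- Vector fields, being derivations, are local operators. -/
theorem vfield_local (X : VField K (SmoothFun I M K))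
    (g : SmoothFun I M K) (x : M) (hg : ∀ᶠ z in nhds x, g z = 0) :
    (X g) x = 0 := by
  obtain ⟨b, -, hb⟩ := (SmoothBumpFunction.nhds_basis_support (I := I) hg).mem_iff.1 hg
  let ρ : SmoothFun I M K := ⟨fun z => ((b z : ℝ) : K),
    (RCLike.ofRealCLM (K := K)).contDiff.contMDiff.comp b.contMDiff⟩
  have hρ : ∀ z, ρ z = ((b z : ℝ) : K) := fun _ => rfl
  have h0 : ρ * g = 0 := by
    apply DFunLike.ext
    intro z
    by_cases hz : z ∈ Function.support b
    · have : g z = 0 := hb hz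
      simp [this]
    · simp [hρ, Function.notMem_support.1 hz]
  have h1 := congrArg (fun f : SmoothFun I M K => f x) (X.leibniz ρ g)
  have hgx : g x = 0 := hg.self_of_nhds
  simpa [h0, hgx, hρ, b.eq_one, smul_eq_mul] using h1.symm

theorem lie_mem_E (F : Foliation I M K p q) {X Y : VField K (SmoothFun I M K)}
    (hX : X ∈ F.E) (hY : Y ∈ F.E) : ⁅X, Y⁆ ∈ F.E := by
  intro φ hφ x hx i f hf
  have hev : ∀ Z ∈ F.E, ∀ᶠ z in nhds x, (Z f) z = 0 := by
    intro Z hZ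
    filter_upwards [hf.eventually_nhds, φ.open_source.mem_nhds hx] with z hz hzs
    exact hZ φ hφ z hzs i f hz
  rw [Derivation.commutator_apply]
  have h1 := vfield_local X (Y f) x (hev Y hY)
  have h2 := vfield_local Y (X f) x (hev X hX)
  simp [h1, h2]

theorem extCovDeriv_idealOne (F : Foliation I M K p q)
    (nab : Connection K (SmoothFun I M K) F.Normal) (r : ℕ) :
    F.idealOne r ≤ (F.idealOne (r + 1)).comap (extCovDerivL nab r) := by
  intro c hc X hX
  change koszul nab c X = 0
  have h0 : ∀ Z, nab.D Z 0 = 0 := fun Z => (nab.DL Z).map_zero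
  rw [koszul, Finset.sum_eq_zero, Finset.sum_eq_zero, sub_zero]
  · intro i _
    refine Finset.sum_eq_zero fun j _ => ?_
    rw [hc, smul_zero]
    intro k
    by_cases h : k = j
    · subst h
      simpa using F.lie_mem_E (hX _) (hX _)
    · rw [Function.update_of_ne h]
      exact hX _
  · intro i _
    rw [hc (i.removeNth X) fun j => hX _, h0, smul_zero]

/-- The differential `d_F : C_F^r(M; Q(F)) → C_F^{r+1}(M; Q(F))`: the covariant exterior derivative
of a Bott connection `∇` on `Q(F)`, modulo `I_1^{r+1}(M; Q(F))`. -/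
def dF (F : Foliation I M K p q) (nab : Connection K (SmoothFun I M K) F.Normal) (r : ℕ) :
    F.Cochain r →ₗ[K] F.Cochain (r + 1) :=
  (F.idealOne r).mapQ (F.idealOne (r + 1)) (extCovDerivL nab r) (F.extCovDeriv_idealOne nab r)

/-- `d_F` does not depend on the choice of the Bott connection on `Q(F)`; hence neither do the
cohomology groups below. -/
theorem dF_eq (F : Foliation I M K p q)
    (nab nab' : Connection K (SmoothFun I M K) F.Normal)
    (h : F.IsBott nab) (h' : F.IsBott nab') (r : ℕ) : F.dF nab r = F.dF nab' r := by
  ext c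
  change Submodule.Quotient.mk (extCovDeriv nab c) = Submodule.Quotient.mk (extCovDeriv nab' c)
  rw [Submodule.Quotient.eq]
  intro X hX
  rw [AlternatingMap.sub_apply, extCovDeriv_apply, extCovDeriv_apply, koszul, koszul,
    sub_sub_sub_cancel_right, sub_eq_zero]
  refine Finset.sum_congr rfl fun i _ => ?_
  obtain ⟨Y, hY⟩ := F.E.mkQ_surjective (c (i.removeNth X))
  rw [← hY, h _ (hX i), h' _ (hX i)]

/-- The cocycles of degree `r`. -/
def cocycles (F : Foliation I M K p q) (nab : Connection K (SmoothFun I M K) F.Normal)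
    (r : ℕ) : Submodule K (F.Cochain r) := LinearMap.ker (F.dF nab r)

/-- The coboundaries of degree `r` (zero for `r = 0`). -/
def coboundaries (F : Foliation I M K p q)
    (nab : Connection K (SmoothFun I M K) F.Normal) :
    (r : ℕ) → Submodule K (F.Cochain r)
  | 0 => ⊥
  | r + 1 => LinearMap.range (F.dF nab r)

/-- `H^r(M; Θ_F) = H_F^r(M; Q(F))`: the cohomology of the complex `(C_F^*(M; Q(F)), d_F)`, which
resolves the sheaf of germs of vector fields preserving `F`, taken modulo `E(F)`. -/
abbrev Cohomology (F : Foliation I M K p q)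
    (nab : Connection K (SmoothFun I M K) F.Normal) (r : ℕ) : Type _ :=
  F.cocycles nab r ⧸ (F.coboundaries nab r).submoduleOf (F.cocycles nab r)

/-- `T : H^r(M; Θ_F) → H^{r+1}(M; Θ_F)` is induced by `θ ∧ ·`: for every cocycle `c`, the cochain
`θ ∧ c` is a cocycle, and `T` maps the class of `c` to the class of `θ ∧ c`. -/
def IsInducedByWedge (F : Foliation I M K p q)
    (nab : Connection K (SmoothFun I M K) F.Normal) (r : ℕ)
    (θ : OneForm K (SmoothFun I M K))
    (T : F.Cohomology nab r → F.Cohomology nab (r + 1)) : Prop :=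
  ∀ c : F.cocycles nab r, ∃ h : F.wedge r θ c ∈ F.cocycles nab (r + 1),
    T (Submodule.Quotient.mk c) = Submodule.Quotient.mk ⟨F.wedge r θ c, h⟩

end Local

end Foliation

end Geometry

/-! Only values on $E(\mathcal F)$ matter, because a form lies in $I_1^r$ as soon as it vanishes on
$E(\mathcal F)$. There a Bott connection on $K_{\mathcal F}^{-1}$ is the Lie derivative, which is
flat by the Jacobi identity (`IsBottAnticanonical.flat`). For a line bundle the curvature is
$d\theta^e$, so $d\theta^e$ vanishes on pairs from $E(\mathcal F)$ (`connectionForm_closed`). Hence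
$d_{\mathcal F}(\theta^e\wedge c)=-\theta^e\wedge d_{\mathcal F}c$ (`koszul_wedgeOne`, `dF_wedge`),
and the wedge product preserves cocycles and coboundaries.

Changing $\mathcal D$ does not change $\theta^e$ on $E(\mathcal F)$. If $e'=fe$, then
$\theta^{e'}=\theta^e+df/f$ on $E(\mathcal F)$. A homotopy from $e$ to $e'$ makes $df/f=dg$ with a
global smooth $g$ (`exists_logarithmic_primitive`): for $K=\mathbb C$ the homotopy is lifted through
the covering $\exp$; for $K=\mathbb R$, $g=\log|f|$. For a cocycle $c$ this gives $\theta^{e'}\wedge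
c-\theta^e\wedge c=dg\wedge c=d_{\mathcal F}(gc)$, a coboundary (`wedge_sub_mem_coboundaries`). -/

/-! ### Cartan calculus for the Koszul formula -/

section Algebra

variable {K A N : Type*} [Field K] [CommRing A] [Algebra K A]
  [AddCommGroup N] [Module A N] [Module K N] [IsScalarTower K A N]

/-- The differential of a function, as a one-form. -/
def differential (K : Type*) {A : Type*} [Field K] [CommRing A] [Algebra K A] (a : A) :
    OneForm K A where
  toFun X := X a
  map_add' _ _ := rfl
  map_smul' _ _ := rfl

theorem differential_apply (a : A) (X : VField K A) : differential K a X = X a := rfl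

/-- The bracket terms are $A$-linear in $c$, so only the Leibniz rule of the connection contributes,
and its extra terms add up to $da\wedge c$. -/
theorem koszul_smul_fun {r : ℕ} (nab : Connection K A N) (a : A) (c : DForm K A N r)
    (X : Fin (r + 1) → VField K A) :
    koszul nab (a • c) X = wedgeOne (differential K a) c X + a • koszul nab c X := by
  simp only [koszul, wedgeOne_apply, AlternatingMap.smul_apply, nab.leibniz, smul_add,
    Finset.sum_add_distrib, smul_sub, Finset.smul_sum, differential_apply,
    smul_comm a ((-1 : ℤ) ^ _)]
  abel

theorem zero_removeNth_vecCons {V : Type*} {r : ℕ} (x : V) (v : Fin r → V) :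
    (0 : Fin (r + 1)).removeNth (Matrix.vecCons x v) = v := rfl

theorem succ_removeNth_vecCons {V : Type*} {r : ℕ} (x : V) (v : Fin (r + 1) → V)
    (i : Fin (r + 1)) :
    i.succ.removeNth (Matrix.vecCons x v) = Matrix.vecCons x (i.removeNth v) := by
  ext j : 1
  refine Fin.cases ?_ (fun j => ?_) j <;> simp [Fin.removeNth]

theorem update_vecCons_succ {V : Type*} {r : ℕ} (x z : V) (w : Fin r → V) (k : Fin r) :
    Function.update (Matrix.vecCons x w) k.succ z =
      Matrix.vecCons x (Function.update w k z) := by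
  simp [Matrix.vecCons, Fin.cons_update]

/-- Contraction with $x$ is an antiderivation of the wedge product: apart from the term in which
$\theta$ takes $x$, the vector $x$ stays the first argument of $c$ and every sign shifts by one. -/
theorem wedgeOne_cons {r : ℕ} (θ : OneForm K A) (c : DForm K A N (r + 1)) (x : VField K A)
    (v : Fin (r + 1) → VField K A) :
    wedgeOne θ c (Matrix.vecCons x v) = θ x • c v - wedgeOne θ (c.curryLeft x) v := by
  rw [wedgeOne_apply, wedgeOne_apply, Fin.sum_univ_succ]
  simp only [zero_removeNth_vecCons, succ_removeNth_vecCons, Matrix.cons_val_zero,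
    Matrix.cons_val_succ, AlternatingMap.curryLeft_apply_apply, Fin.val_zero, pow_zero, one_smul,
    Fin.val_succ, pow_succ, mul_neg, mul_one, neg_smul, Finset.sum_neg_distrib, sub_eq_add_neg]

/-- Cartan's formula: the first argument of the covariant exterior derivative. -/
theorem koszul_cons {r : ℕ} (nab : Connection K A N) (c : DForm K A N (r + 1))
    (x : VField K A) (v : Fin (r + 1) → VField K A) :
    koszul nab c (Matrix.vecCons x v) =
      nab.D x (c v) - ∑ k, c (Function.update v k ⁅x, v k⁆) - koszul nab (c.curryLeft x) v := by
  -- Pairs of indices avoiding the first argument: shifting both indices down by one gives the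
  -- bracket terms of the contraction, with opposite sign. The pairs that contain the first
  -- argument, treated in `h0`, make up the bracket part of the Lie derivative.
  have hs : ∀ i : Fin r, (∑ j ≥ i.succ, (-1 : ℤ) ^ (i.succ : ℕ) •
        c (Function.update (i.succ.castSucc.removeNth (Matrix.vecCons x v)) j
          ⁅Matrix.vecCons x v i.succ.castSucc, Matrix.vecCons x v j.succ⁆)) =
      - ∑ j ≥ i, (-1 : ℤ) ^ (i : ℕ) • c.curryLeft x
        (Function.update (i.castSucc.removeNth v) j ⁅v i.castSucc, v j.succ⁆) := by
    intro i
    have hI : Finset.Ici i.succ = (Finset.Ici i).map (Fin.succEmb r) := by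
      ext j
      refine Fin.cases ?_ (fun j => ?_) j <;> simp
    rw [hI, Finset.sum_map, ← Finset.sum_neg_distrib]
    refine Finset.sum_congr rfl fun j _ => ?_
    rw [← Fin.succ_castSucc, succ_removeNth_vecCons]
    simp only [Fin.coe_succEmb, update_vecCons_succ, Matrix.cons_val_succ,
      AlternatingMap.curryLeft_apply_apply, Fin.val_succ, pow_succ, mul_neg, mul_one, neg_smul]
  have h0 : (∑ j ≥ (0 : Fin (r + 1)), (-1 : ℤ) ^ ((0 : Fin (r + 1)) : ℕ) •
        c (Function.update ((0 : Fin (r + 1)).castSucc.removeNth (Matrix.vecCons x v)) j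
          ⁅Matrix.vecCons x v (0 : Fin (r + 1)).castSucc, Matrix.vecCons x v j.succ⁆)) =
      ∑ k, c (Function.update v k ⁅x, v k⁆) := by
    have hI : Finset.Ici (0 : Fin (r + 1)) = Finset.univ := by
      ext j; simp
    rw [hI]
    simp
  rw [koszul, koszul, Fin.sum_univ_succ, Fin.sum_univ_succ (n := r) (f := fun i => ∑ j ≥ i, _),
    h0, Finset.sum_congr rfl fun i _ => hs i]
  simp only [zero_removeNth_vecCons, succ_removeNth_vecCons, Matrix.cons_val_zero,
    Matrix.cons_val_succ, AlternatingMap.curryLeft_apply_apply, Fin.val_zero, pow_zero, one_smul,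
    Fin.val_succ, pow_succ, mul_neg, mul_one, neg_smul, Finset.sum_neg_distrib]
  abel

/-- The Lie derivative is a derivation of the wedge product. -/
theorem sum_wedgeOne_update {r : ℕ} (θ : OneForm K A) (c : DForm K A N (r + 1))
    (x : VField K A) (v : Fin (r + 2) → VField K A) :
    ∑ k, wedgeOne θ c (Function.update v k ⁅x, v k⁆) =
      ∑ i : Fin (r + 2), (-1) ^ (i : ℕ) • (θ ⁅x, v i⁆ • c (i.removeNth v) +
        θ (v i) • ∑ j, c (Function.update (i.removeNth v) j ⁅x, i.removeNth v j⁆)) := by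
  simp only [wedgeOne_apply]
  rw [Finset.sum_comm]
  refine Finset.sum_congr rfl fun i _ => ?_
  -- With the argument $i$ fed to $\theta$ fixed, the bracket sits either in slot $i$ or in one of
  -- the slots left to $c$.
  rw [← Finset.smul_sum, Fin.sum_univ_succAbove _ i, Finset.smul_sum]
  congr 2
  · simp
  · refine Finset.sum_congr rfl fun j _ => ?_
    rw [Fin.removeNth_update_succAbove, Function.update_of_ne (Fin.succAbove_ne i j).symm]
    rfl

/-- `d^∇(θ ∧ c) = - θ ∧ d^∇ c` on a set of vector fields on which `dθ` vanishes. -/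
theorem koszul_wedgeOne [CharZero K] (nab : Connection K A N) (θ : OneForm K A)
    (S : Set (VField K A))
    (hθ : ∀ X ∈ S, ∀ Y ∈ S, X (θ Y) - Y (θ X) = θ ⁅X, Y⁆) {r : ℕ} (c : DForm K A N r)
    (X : Fin (r + 2) → VField K A) (hX : ∀ i, X i ∈ S) :
    koszul nab (wedgeOne θ c) X = - wedgeOne θ (extCovDeriv nab c) X := by
  induction r with
  | zero =>
    have hc : ∀ v : Fin 0 → VField K A, c v = c 0 := fun v => congrArg c (Subsingleton.elim _ _)
    have hu : ∀ (v : Fin 1 → VField K A) (y : VField K A), Function.update v 0 y 0 = y := by simp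
    have hI : Finset.Ici (0 : Fin 1) = Finset.univ := by
      ext j; simp
    simp only [koszul, wedgeOne_apply, extCovDeriv_apply, Fin.sum_univ_succ, Fin.sum_univ_zero,
      hI, hc, hu]
    simp [Fin.removeNth, nab.leibniz, sub_smul, ← hθ _ (hX _) _ (hX _)]
    abel
  | succ r ih =>
    -- Induction by Cartan's formula $\iota_x d=L_x-d\iota_x$. On `S` the hypothesis reads
    -- $L_x\theta=d(\theta(x))$, so this term of $L_x(\theta\wedge c)$ cancels the one from
    -- $d(\theta(x)c)$. What remains is $-\theta(x)\,dc+\theta\wedge\iota_x dc=-\iota_x(\theta\wedge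
    -- dc)$. Brackets occur only under $\theta$ or inside $c$, so `S` need not be closed under them.
    obtain ⟨x, v, rfl⟩ : ∃ x v, X = Matrix.vecCons x v :=
      ⟨_, _, (Matrix.cons_head_tail X).symm⟩
    have hx : x ∈ S := hX 0
    have hv : ∀ i, v i ∈ S := fun i => hX i.succ
    have h1 : (wedgeOne θ c).curryLeft x = θ x • c - wedgeOne θ (c.curryLeft x) := by
      ext w
      rw [AlternatingMap.curryLeft_apply_apply, wedgeOne_cons]
      rfl
    have h2 : koszul nab ((wedgeOne θ c).curryLeft x) v =
        wedgeOne (differential K (θ x)) c v + θ x • koszul nab c v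
          + wedgeOne θ (extCovDeriv nab (c.curryLeft x)) v := by
      have := congrArg (fun η => η v) ((extCovDerivL nab _).map_sub (θ x • c)
        (wedgeOne θ (c.curryLeft x)))
      rw [h1, ← koszul_smul_fun]
      change koszul nab _ v = koszul nab _ v - koszul nab _ v at this
      rw [this, ih _ v hv, sub_neg_eq_add]
    have hD : nab.D x (wedgeOne θ c v) = ∑ i : Fin (r + 2), (-1) ^ (i : ℕ) •
        (x (θ (v i)) • c (i.removeNth v) + θ (v i) • nab.D x (c (i.removeNth v))) := by
      rw [wedgeOne_apply]
      change nab.DL x _ = _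
      rw [map_sum]
      refine Finset.sum_congr rfl fun i _ => ?_
      rw [map_zsmul]
      exact congrArg _ (nab.leibniz _ _ _)
    rw [koszul_cons, h2, wedgeOne_cons, sum_wedgeOne_update, hD, extCovDeriv_apply, neg_sub]
    simp only [wedgeOne_apply, AlternatingMap.curryLeft_apply_apply, extCovDeriv_apply, koszul_cons,
      ← hθ x hx _ (hv _), differential_apply, sub_smul, smul_sub, smul_add,
      Finset.sum_add_distrib, Finset.sum_sub_distrib]
    abel

end Algebra

/-! ### The remainder $(e^z-1)/z$ -/

section Exponential

variable {K : Type*} [RCLike K]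

/-- The function $(e^z-1)/z$, with value $1$ at $0$, is entire: a power series at $0$ and a quotient
elsewhere. It turns the chain rule for $\exp$ into an application of the Leibniz rule. -/
theorem contDiff_dslope_exp : ContDiff ℝ ∞ (dslope (NormedSpace.exp : K → K) 0) := by
  rw [contDiff_iff_contDiffAt]
  intro z
  rcases eq_or_ne z 0 with rfl | hz
  · have h := (NormedSpace.exp_hasFPowerSeriesAt_zero (𝕂 := K) (𝔸 := K)).has_fpower_series_dslope_fslope
    exact (h.analyticAt.contDiffAt).restrict_scalars ℝ
  · have he : ContDiffAt ℝ ∞ (fun w : K => w⁻¹ • (NormedSpace.exp w - 1)) z := by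
      refine ContDiffAt.restrict_scalars (𝕜' := K) ℝ ?_
      exact (contDiffAt_inv K hz).smul
        (((NormedSpace.exp_analytic (𝕂 := K) z).contDiffAt).sub contDiffAt_const)
    refine he.congr_of_eventuallyEq ?_
    filter_upwards [isOpen_ne.mem_nhds hz] with w hw
    rw [dslope_of_ne _ hw, slope_def_module]
    simp

theorem exp_eq_one_add_mul_dslope (z : K) :
    NormedSpace.exp z = 1 + z * dslope (NormedSpace.exp : K → K) 0 z := by
  have := sub_smul_dslope (NormedSpace.exp : K → K) 0 z
  simp only [sub_zero, smul_eq_mul, NormedSpace.exp_zero] at this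
  rw [this]; ring

theorem dslope_exp_zero : dslope (NormedSpace.exp : K → K) 0 0 = 1 := by
  rw [dslope_same]
  exact (hasDerivAt_exp_zero (𝕂 := K)).deriv

end Exponential

/-! ### Smooth logarithms of nowhere vanishing functions -/

section Geometry

variable {EM HM : Type*} [NormedAddCommGroup EM] [NormedSpace ℝ EM] [TopologicalSpace HM]
  {I : ModelWithCorners ℝ EM HM} {M : Type*} [TopologicalSpace M] [ChartedSpace HM M]
  {K : Type*} [RCLike K]

theorem SmoothFun.algebraMap_apply (k : K) (x : M) :
    (algebraMap K (SmoothFun I M K) k) x = k := rfl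

theorem SmoothFun.one_apply (x : M) : (1 : SmoothFun I M K) x = 1 := rfl

/-- The chain rule for the exponential function. -/
theorem vfield_exp (X : VField K (SmoothFun I M K)) (u g : SmoothFun I M K)
    (h : ∀ x, u x = NormedSpace.exp (g x)) : X u = u * X g := by
  apply DFunLike.ext
  intro x
  -- Vector fields are abstract derivations, so the chain rule is derived from a factorization
  -- around the point $x$: $u=u(x)\,(1+(g-g(x))\,m)$. After the Leibniz rule, evaluation at $x$
  -- leaves $u(x)\,m(x)\,(Xg)(x)$, and $m(x)=1$.
  let m : SmoothFun I M K := ⟨fun y => dslope (NormedSpace.exp : K → K) 0 (g y - g x),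
    contDiff_dslope_exp.contMDiff.comp (g.smooth.sub contMDiff_const)⟩
  have hm : ∀ y, m y = dslope (NormedSpace.exp : K → K) 0 (g y - g x) := fun _ => rfl
  have hu : u = u x • (1 + (g - algebraMap K _ (g x)) * m) := by
    apply DFunLike.ext
    intro y
    simp only [SmoothFun.smul_apply, SmoothFun.add_apply, SmoothFun.mul_apply,
      SmoothFun.sub_apply, SmoothFun.algebraMap_apply, SmoothFun.one_apply, hm]
    rw [← exp_eq_one_add_mul_dslope, h, h, ← NormedSpace.exp_add, add_sub_cancel]
  have hX : X u = u x • ((g - algebraMap K _ (g x)) * X m + m * X g) := by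
    conv_lhs => rw [hu]
    simp
  rw [hX]
  have hmx : m x = 1 := by rw [hm, sub_self, dslope_exp_zero]
  simp [hmx, SmoothFun.algebraMap_apply]

/-- A continuous logarithm of a smooth function is smooth. -/
theorem contMDiff_of_exp {u g : M → ℂ} (hu : ContMDiff I 𝓘(ℝ, ℂ) ∞ u) (hg : Continuous g)
    (h : ∀ x, Complex.exp (g x) = u x) : ContMDiff I 𝓘(ℝ, ℂ) ∞ g := by
  intro x
  -- Near $x$, $g$ equals $g(x)+\log(u\,e^{-g(x)})$ with the principal branch, whose argument is $1$
  -- at $x$. Continuity of $g$ keeps the imaginary part of $g(y)-g(x)$ within $(-\pi,\pi)$, where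
  -- that branch inverts $\exp$.
  have hlog : ContDiffAt ℝ ∞ (fun z : ℂ => g x + Complex.log (z * Complex.exp (- g x))) (u x) := by
    refine contDiffAt_const.add (ContDiffAt.comp (g := Complex.log) _ ?_
      (contDiffAt_id.mul contDiffAt_const))
    refine (Complex.contDiffAt_log ?_).restrict_scalars ℝ
    simp [← h, ← Complex.exp_add]
  refine (hlog.contMDiffAt.comp x (hu x)).congr_of_eventuallyEq ?_
  have hnear : ∀ᶠ y in nhds x, ‖g y - g x‖ < Real.pi :=
    (tendsto_iff_norm_sub_tendsto_zero.1 hg.continuousAt).eventually_lt_const Real.pi_pos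
  filter_upwards [hnear] with y hy
  have him := abs_lt.1 ((Complex.abs_im_le_norm _).trans_lt hy)
  rw [Function.comp_apply, ← h, ← Complex.exp_add, ← sub_eq_add_neg,
    Complex.log_exp him.1 him.2.le, add_sub_cancel]

/-- A function homotopic to `1` through functions without zeros has a continuous logarithm. -/
theorem exists_continuous_log (h : unitInterval × M → ℂ) (hc : Continuous h) (h0 : ∀ s, h s ≠ 0)
    (h1 : ∀ x, h (0, x) = 1) : ∃ g : M → ℂ, Continuous g ∧ ∀ x, Complex.exp (g x) = h (1, x) := by
  let H : C(unitInterval × M, {z : ℂ // z ≠ 0}) := ⟨fun s => ⟨h s, h0 s⟩, hc.subtype_mk _⟩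
  -- The lift starts at the constant $0$, a logarithm of $h(0,\cdot)=1$. Homotopy lifting holds over
  -- all of $M$ at once, so no assumption on its fundamental group enters.
  let L := Complex.isCoveringMap_exp.liftHomotopy H (ContinuousMap.const M 0)
    (fun x => Subtype.ext (by simp [H, h1]))
  refine ⟨fun x => L (1, x), by fun_prop, fun x => ?_⟩
  exact congrArg Subtype.val (congrFun (Complex.isCoveringMap_exp.liftHomotopy_lifts H
    (ContinuousMap.const M 0) (fun x => Subtype.ext (by simp [H, h1]))) (1, x))

/-- The logarithmic differential of a function that is homotopic to `1` through functions without
zeros is exact. -/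
theorem exists_logarithmic_primitive (h : unitInterval × M → K) (f : SmoothFun I M K)
    (hc : Continuous h) (h0 : ∀ s, h s ≠ 0) (h1 : ∀ x, h (0, x) = 1) (hf : ∀ x, h (1, x) = f x) :
    ∃ g : SmoothFun I M K, ∀ X : VField K (SmoothFun I M K), X f = f * X g := by
  have hf0 : ∀ x, f x ≠ 0 := fun x => hf x ▸ h0 _
  rcases RCLike.I_eq_zero_or_im_I_eq_one (K := K) with hI | hI
  -- The case $K=\mathbb R$, with $g=\log|f|$.
  · have hre : ∀ z : K, ((RCLike.re z : ℝ) : K) = z := fun z => by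
      simpa [hI] using RCLike.re_add_im z
    have hr0 : ∀ x, RCLike.re (f x) ≠ 0 := fun x hx => hf0 x (by rw [← hre (f x), hx]; simp)
    let g : SmoothFun I M K := ⟨fun x => ((Real.log (RCLike.re (f x)) : ℝ) : K), by
      intro x
      have : ContDiffAt ℝ ∞ (fun z : K => ((Real.log (RCLike.re z) : ℝ) : K)) (f x) :=
        (RCLike.ofRealCLM (K := K)).contDiff.contDiffAt.comp _
          ((Real.contDiffAt_log.2 (hr0 x)).comp _ (RCLike.reCLM (K := K)).contDiff.contDiffAt)
      exact this.contMDiffAt.comp x (f.smooth x)⟩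
    have hg : ∀ x, g x = ((Real.log (RCLike.re (f x)) : ℝ) : K) := fun _ => rfl
    refine ⟨g, fun X => ?_⟩
    -- As $e^g=|f|$, squaring removes the sign: $f^2=e^{2g}$ gives $2f\,Xf=2f^2\,Xg$, and $2f$
    -- cancels pointwise.
    have hX := vfield_exp X (f * f) (g + g) fun x => by
      have hexp : NormedSpace.exp ((Real.log (RCLike.re (f x)) : ℝ) : K) =
          ((|RCLike.re (f x)| : ℝ) : K) := by
        rw [← Real.exp_log_eq_abs (hr0 x), Real.exp_eq_exp_ℝ]
        exact (NormedSpace.map_exp (algebraMap ℝ K) RCLike.continuous_ofReal _).symm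
      rw [SmoothFun.add_apply, NormedSpace.exp_add, hg, hexp, ← RCLike.ofReal_mul, abs_mul_abs_self,
        RCLike.ofReal_mul, hre, SmoothFun.mul_apply]
    apply DFunLike.ext
    intro x
    have hx := congrArg (fun u : SmoothFun I M K => u x) hX
    simp only [Derivation.leibniz, map_add, SmoothFun.add_apply, SmoothFun.mul_apply,
      smul_eq_mul] at hx
    rw [SmoothFun.mul_apply]
    refine mul_left_cancel₀ (mul_ne_zero two_ne_zero (hf0 x)) ?_
    linear_combination hx
  -- The case $K\cong\mathbb C$: the logarithm is found in $\mathbb C$ and carried back by the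
  -- continuous ring isomorphism, which commutes with $\exp$.
  · let ψ := RCLike.complexLinearIsometryEquiv (𝕜 := K) hI
    obtain ⟨g, hgc, hg⟩ := exists_continuous_log (fun s => ψ (h s)) (ψ.continuous.comp hc)
      (fun s => by simpa using h0 s) (fun x => by
        rw [h1]; exact map_one (RCLike.complexRingEquiv hI))
    have hgs : ContMDiff I 𝓘(ℝ, ℂ) ∞ g := contMDiff_of_exp
      (u := fun x => ψ (f x)) (ψ.contDiff.contMDiff.comp f.smooth) hgc (fun x => by rw [hg, hf])
    refine ⟨⟨fun x => ψ.symm (g x), ψ.symm.contDiff.contMDiff.comp hgs⟩, fun X =>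
      vfield_exp X f _ fun x => ?_⟩
    change f x = NormedSpace.exp (ψ.symm (g x))
    have := NormedSpace.map_exp ((RCLike.complexRingEquiv hI).symm : ℂ →+* K) ψ.symm.continuous (g x)
    rw [← Complex.exp_eq_exp_ℂ, hg, hf] at this
    exact (ψ.symm_apply_apply (f x)).symm.trans this

end Geometry

/-! ### Commutators of derivation-like actions on families -/

/-- The action of an endomorphism on a family of alternating values, with the term in which both
endomorphisms act on the same argument split off. -/
theorem sum_sum_update {ι V W : Type*} [Fintype ι] [DecidableEq ι] [AddCommGroup W]
    (G : (ι → V) → W) (a b : V → V) (Z : ι → V) :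
    ∑ i, ∑ j, G (Function.update (Function.update Z i (b (Z i))) j
        (a (Function.update Z i (b (Z i)) j))) =
      ∑ i, G (Function.update Z i (a (b (Z i)))) +
        ∑ i, ∑ j, if i = j then 0 else
          G (Function.update (Function.update Z i (b (Z i))) j (a (Z j))) := by
  rw [← Finset.sum_add_distrib]
  refine Finset.sum_congr rfl fun i _ => ?_
  have hi : G (Function.update Z i (a (b (Z i)))) =
      ∑ j, if i = j then G (Function.update Z i (a (b (Z i)))) else 0 := by
    simp
  rw [hi, ← Finset.sum_add_distrib]
  refine Finset.sum_congr rfl fun j _ => ?_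
  split_ifs with h
  · subst h; simp
  · rw [Function.update_of_ne (Ne.symm h), zero_add]

/-- The actions of two endomorphisms as derivations on families commute up to the action of the
commutator. -/
theorem sum_sum_update_comm {ι V W : Type*} [Fintype ι] [DecidableEq ι] [AddCommGroup W]
    (G : (ι → V) → W) (a b : V → V) (Z : ι → V) :
    ∑ i, ∑ j, G (Function.update (Function.update Z i (b (Z i))) j
        (a (Function.update Z i (b (Z i)) j))) -
      ∑ i, ∑ j, G (Function.update (Function.update Z i (a (Z i))) j
        (b (Function.update Z i (a (Z i)) j))) =
      ∑ i, (G (Function.update Z i (a (b (Z i)))) - G (Function.update Z i (b (a (Z i))))) := by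
  -- Updates in different slots commute, so the terms off the diagonal are symmetric in the two
  -- actions and drop out of the commutator.
  have hswap : (∑ i, ∑ j, if i = j then 0 else
        G (Function.update (Function.update Z i (b (Z i))) j (a (Z j)))) =
      ∑ i, ∑ j, if i = j then 0 else
        G (Function.update (Function.update Z i (a (Z i))) j (b (Z j))) := by
    rw [Finset.sum_comm]
    refine Finset.sum_congr rfl fun i _ => Finset.sum_congr rfl fun j _ => ?_
    by_cases h : i = j
    · simp [h]
    · rw [if_neg h, if_neg (Ne.symm h), Function.update_comm h]
  rw [sum_sum_update, sum_sum_update G b a, hswap, Finset.sum_sub_distrib]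
  abel

/-- The curvature computation in rank one: with $a=X\theta(Y)$, $b=Y\theta(X)$, $c=\theta(Y)$,
$d=\theta(X)$, the quadratic terms cancel because scalars commute. -/
theorem sub_smul_eq_add_smul_smul_sub {A N : Type*} [CommRing A] [AddCommGroup N] [Module A N]
    (a b c d : A) (s : N) : (a - b) • s = a • s + c • d • s - (b • s + d • c • s) := by
  rw [sub_smul, smul_comm c d]
  abel

/-! ### Bott connections on $K_{\mathcal F}^{-1}$ and their connection forms -/

section Geometry

namespace Foliation

variable {EM HM : Type*} [NormedAddCommGroup EM] [NormedSpace ℝ EM] [TopologicalSpace HM]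
  {I : ModelWithCorners ℝ EM HM} {M : Type*} [TopologicalSpace M] [ChartedSpace HM M]
  {K : Type*} [RCLike K] {p q : ℕ}

/-- The decomposable section `πZ_1 ∧ … ∧ πZ_q` of `K_F^{-1}`. -/
noncomputable def decomposable (F : Foliation I M K p q)
    (Z : Fin q → VField K (SmoothFun I M K)) : F.Anticanonical :=
  exteriorPower.ιMulti (SmoothFun I M K) q fun j => F.proj (Z j)

theorem decomposable_update (F : Foliation I M K p q)
    (Z : Fin q → VField K (SmoothFun I M K)) (i : Fin q) (X : VField K (SmoothFun I M K)) :
    F.decomposable (Function.update Z i X) = exteriorPower.ιMulti (SmoothFun I M K) q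
      (Function.update (fun j => F.proj (Z j)) i (F.proj X)) := by
  refine congrArg (exteriorPower.ιMulti (SmoothFun I M K) q) (funext fun j => ?_)
  by_cases h : j = i
  · subst h; simp
  · simp [h]

theorem decomposable_update_sub (F : Foliation I M K p q)
    (Z : Fin q → VField K (SmoothFun I M K)) (i : Fin q) (X Y : VField K (SmoothFun I M K)) :
    F.decomposable (Function.update Z i (X - Y)) =
      F.decomposable (Function.update Z i X) - F.decomposable (Function.update Z i Y) := by
  simp only [decomposable_update, map_sub, AlternatingMap.map_update_sub]

/-- The Bott condition prescribes $\mathcal D_X$ only on decomposable sections. Since these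
generate, an identity extends to all sections once its defect is known to be linear over functions.
-/
theorem linearMap_eq_zero_of_decomposable (F : Foliation I M K p q)
    (δ : F.Anticanonical →ₗ[SmoothFun I M K] F.Anticanonical)
    (h : ∀ Z, δ (F.decomposable Z) = 0) (s : F.Anticanonical) : δ s = 0 := by
  have : δ = 0 := by
    apply exteriorPower.linearMap_ext
    ext n
    choose Z hZ using fun j => F.E.mkQ_surjective (n j)
    have hn : n = fun j => F.proj (Z j) := funext fun j => (hZ j).symm
    rw [hn]
    exact congrArg Subtype.val (h Z)
  rw [this, LinearMap.zero_apply]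

variable {F : Foliation I M K p q}

theorem IsBottAnticanonical.decomposable {D : Connection K (SmoothFun I M K) F.Anticanonical}
    (hD : F.IsBottAnticanonical D) {X : VField K (SmoothFun I M K)} (hX : X ∈ F.E)
    (Z : Fin q → VField K (SmoothFun I M K)) :
    D.D X (F.decomposable Z) = ∑ i, F.decomposable (Function.update Z i ⁅X, Z i⁆) := by
  simp only [decomposable_update]
  exact hD X hX Z

/-- Along `E(F)`, all Bott connections on `K_F^{-1}` agree. -/
theorem IsBottAnticanonical.eq {D D' : Connection K (SmoothFun I M K) F.Anticanonical}
    (hD : F.IsBottAnticanonical D) (hD' : F.IsBottAnticanonical D')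
    {X : VField K (SmoothFun I M K)} (hX : X ∈ F.E) (s : F.Anticanonical) :
    D.D X s = D'.D X s := by
  -- The difference of two connections is tensorial: the terms $(Xa)s$ cancel.
  let δ : F.Anticanonical →ₗ[SmoothFun I M K] F.Anticanonical :=
    { toFun := fun s => D.D X s - D'.D X s
      map_add' := fun s t => by rw [D.add_right, D'.add_right]; abel
      map_smul' := fun a s => by
        rw [D.leibniz, D'.leibniz, RingHom.id_apply, smul_sub]; abel }
  refine sub_eq_zero.1 (F.linearMap_eq_zero_of_decomposable δ (fun Z => ?_) s)
  change D.D X _ - D'.D X _ = 0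
  rw [hD.decomposable hX, hD'.decomposable hX, sub_self]

section Local

variable [FiniteDimensional ℝ EM] [IsManifold I ∞ M] [T2Space M]

/-- Bott connections on `K_F^{-1}` are flat along `E(F)`. -/
theorem IsBottAnticanonical.flat {D : Connection K (SmoothFun I M K) F.Anticanonical}
    (hD : F.IsBottAnticanonical D) {X Y : VField K (SmoothFun I M K)} (hX : X ∈ F.E)
    (hY : Y ∈ F.E) (s : F.Anticanonical) :
    D.D X (D.D Y s) - D.D Y (D.D X s) = D.D ⁅X, Y⁆ s := by
  -- The curvature is tensorial in $s$, so decomposable sections suffice.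
  let δ : F.Anticanonical →ₗ[SmoothFun I M K] F.Anticanonical :=
    { toFun := fun s => D.D X (D.D Y s) - D.D Y (D.D X s) - D.D ⁅X, Y⁆ s
      map_add' := fun s t => by simp only [D.add_right]; abel
      map_smul' := fun a s => by
        simp only [D.leibniz, D.add_right, RingHom.id_apply, smul_sub,
          Derivation.commutator_apply, sub_smul]
        abel }
  refine sub_eq_zero.1 (F.linearMap_eq_zero_of_decomposable δ (fun Z => ?_) s)
  change D.D X (D.D Y _) - D.D Y (D.D X _) - D.D ⁅X, Y⁆ _ = 0
  have hsum : ∀ U ∈ F.E, ∀ G : Fin q → Fin q → VField K (SmoothFun I M K),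
      D.D U (∑ i, F.decomposable (G i)) =
        ∑ i, ∑ j, F.decomposable (Function.update (G i) j ⁅U, G i j⁆) := by
    intro U hU G
    change D.DL U _ = _
    rw [map_sum]
    exact Finset.sum_congr rfl fun i _ => hD.decomposable hU _
  rw [hD.decomposable hX, hD.decomposable hY, hD.decomposable (F.lie_mem_E hX hY),
    hsum X hX, hsum Y hY,
    sum_sum_update_comm F.decomposable (fun U => ⁅X, U⁆) (fun U => ⁅Y, U⁆) Z, sub_eq_zero]
  refine Finset.sum_congr rfl fun i _ => ?_
  -- The Jacobi identity in each slot.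
  rw [← decomposable_update_sub, lie_lie]

/-- Flatness applied to $s=e$: the coefficient of $e$ in the curvature is $d\theta^e(X,Y)$, and
coefficients with respect to a trivialization are unique. -/
theorem connectionForm_closed (e : F.Trivialization)
    {D : Connection K (SmoothFun I M K) F.Anticanonical} (hD : F.IsBottAnticanonical D) :
    ∀ X ∈ (F.E : Set (VField K (SmoothFun I M K))), ∀ Y ∈ (F.E : Set _),
      X (F.connectionForm e D Y) - Y (F.connectionForm e D X) = F.connectionForm e D ⁅X, Y⁆ := by
  intro X hX Y hY
  apply e.bijective.1
  change _ • e.sec = _ • e.sec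
  rw [connectionForm_smul, ← hD.flat hX hY, ← connectionForm_smul F e D Y,
    ← connectionForm_smul F e D X, D.leibniz, D.leibniz, ← connectionForm_smul F e D X,
    ← connectionForm_smul F e D Y]
  exact sub_smul_eq_add_smul_smul_sub (A := SmoothFun I M K) (N := F.Anticanonical) _ _ _ _ _

/-- Along `E(F)`, the connection forms with respect to homotopic trivializations differ by an exact
form. -/
theorem connectionForm_homotopic {e e' : F.Trivialization}
    {D D' : Connection K (SmoothFun I M K) F.Anticanonical} (hD : F.IsBottAnticanonical D)
    (hD' : F.IsBottAnticanonical D') (hom : e.Homotopic e') :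
    ∃ g : SmoothFun I M K, ∀ X ∈ F.E,
      F.connectionForm e' D' X = F.connectionForm e D X + X g := by
  obtain ⟨h, f, hc, h0, h1, hf, he⟩ := hom
  obtain ⟨g, hg⟩ := exists_logarithmic_primitive h f hc h0 h1 hf
  refine ⟨g, fun X hX => e'.bijective.1 ?_⟩
  change _ • e'.sec = _ • e'.sec
  -- $\mathcal D'_X(fe)=(Xf)e+f\theta^e(X)e=(Xg+\theta^e(X))\,fe$, since $\mathcal D'_X=\mathcal
  -- D_X$ on $E(\mathcal F)$ and $Xf=f\,Xg$.
  rw [connectionForm_smul, he, D'.leibniz, hD'.eq hD hX, ← connectionForm_smul F e D X, hg X,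
    add_smul, smul_smul, smul_smul, smul_smul, mul_comm (X g), mul_comm f (_ : SmoothFun I M K),
    add_comm]
  simp only [mul_comm]

/-! ### The wedge product on cohomology -/

variable (nab : Connection K (SmoothFun I M K) F.Normal)

/-- Equality modulo the ideal is tested on sections of $E(\mathcal F)$ only, which is where
$d\theta$ is assumed to vanish. -/
theorem dF_wedge (θ : OneForm K (SmoothFun I M K))
    (hθ : ∀ X ∈ (F.E : Set (VField K (SmoothFun I M K))), ∀ Y ∈ (F.E : Set _),
      X (θ Y) - Y (θ X) = θ ⁅X, Y⁆) (r : ℕ) (c : F.Cochain r) :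
    F.dF nab (r + 1) (F.wedge r θ c) = - F.wedge (r + 1) θ (F.dF nab r c) := by
  obtain ⟨c, rfl⟩ := Submodule.Quotient.mk_surjective _ c
  change Submodule.Quotient.mk (extCovDeriv nab (wedgeOne θ c)) =
    - Submodule.Quotient.mk (wedgeOne θ (extCovDeriv nab c))
  rw [← Submodule.Quotient.mk_neg, Submodule.Quotient.eq]
  intro X hX
  rw [AlternatingMap.sub_apply, AlternatingMap.neg_apply, extCovDeriv_apply,
    koszul_wedgeOne nab θ F.E hθ c X hX, sub_self]

theorem wedge_mem_cocycles {θ : OneForm K (SmoothFun I M K)}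
    (hθ : ∀ X ∈ (F.E : Set (VField K (SmoothFun I M K))), ∀ Y ∈ (F.E : Set _),
      X (θ Y) - Y (θ X) = θ ⁅X, Y⁆) {r : ℕ} {c : F.Cochain r} (hc : c ∈ F.cocycles nab r) :
    F.wedge r θ c ∈ F.cocycles nab (r + 1) := by
  change F.dF nab (r + 1) _ = 0
  rw [dF_wedge nab θ hθ, show F.dF nab r c = 0 from hc, map_zero, neg_zero]

theorem wedge_mem_coboundaries {θ : OneForm K (SmoothFun I M K)}
    (hθ : ∀ X ∈ (F.E : Set (VField K (SmoothFun I M K))), ∀ Y ∈ (F.E : Set _),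
      X (θ Y) - Y (θ X) = θ ⁅X, Y⁆) {r : ℕ} {c : F.Cochain r} (hc : c ∈ F.coboundaries nab r) :
    F.wedge r θ c ∈ F.coboundaries nab (r + 1) := by
  cases r with
  | zero =>
    rw [(Submodule.mem_bot K).1 hc, map_zero]
    exact zero_mem _
  | succ r =>
    obtain ⟨b, rfl⟩ := hc
    -- The sign compensates for $\theta\wedge$ and $d_{\mathcal F}$ anticommuting.
    refine ⟨- F.wedge r θ b, ?_⟩
    rw [map_neg, dF_wedge nab θ hθ, neg_neg]

/-- Wedging a cocycle with an exact form gives a coboundary. -/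
theorem wedge_sub_mem_coboundaries {θ θ' : OneForm K (SmoothFun I M K)} (g : SmoothFun I M K)
    (hg : ∀ X ∈ F.E, θ' X = θ X + X g) {r : ℕ} {c : F.Cochain r} (hc : c ∈ F.cocycles nab r) :
    F.wedge r θ' c - F.wedge r θ c ∈ F.coboundaries nab (r + 1) := by
  obtain ⟨c, rfl⟩ := Submodule.Quotient.mk_surjective _ c
  have hc0 : ∀ X : Fin (r + 1) → _, (∀ i, X i ∈ F.E) → koszul nab c X = 0 :=
    (Submodule.Quotient.mk_eq_zero _).1 (show Submodule.Quotient.mk (extCovDeriv nab c) = 0 from hc)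
  -- The primitive is $gc$: in $d(gc)=dg\wedge c+g\,dc$ the last term vanishes on $E(\mathcal F)$
  -- because $c$ is a cocycle, and $dg=\theta'-\theta$ there.
  refine ⟨Submodule.Quotient.mk (g • c), ?_⟩
  change Submodule.Quotient.mk (extCovDeriv nab (g • c)) =
    Submodule.Quotient.mk (wedgeOne θ' c) - Submodule.Quotient.mk (wedgeOne θ c)
  rw [← Submodule.Quotient.mk_sub, Submodule.Quotient.eq]
  intro X hX
  rw [AlternatingMap.sub_apply, AlternatingMap.sub_apply, extCovDeriv_apply, koszul_smul_fun,
    hc0 X hX, smul_zero, add_zero, sub_eq_zero]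
  simp only [wedgeOne_apply, differential_apply]
  rw [← Finset.sum_sub_distrib]
  refine Finset.sum_congr rfl fun i _ => ?_
  rw [hg _ (hX i), add_smul, ← smul_sub, add_sub_cancel_left]

theorem exists_isInducedByWedge {θ : OneForm K (SmoothFun I M K)}
    (hθ : ∀ X ∈ (F.E : Set (VField K (SmoothFun I M K))), ∀ Y ∈ (F.E : Set _),
      X (θ Y) - Y (θ X) = θ ⁅X, Y⁆) (r : ℕ) :
    ∃ T : F.Cohomology nab r →ₗ[K] F.Cohomology nab (r + 1), F.IsInducedByWedge nab r θ T :=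
  ⟨Submodule.mapQ _ _ ((F.wedge r θ).restrict fun _ hc => wedge_mem_cocycles nab hθ hc)
    fun _ hc => wedge_mem_coboundaries nab hθ hc,
    fun c => ⟨wedge_mem_cocycles nab hθ c.2, rfl⟩⟩

/-- Two maps induced by one-forms that differ by an exact form along `E(F)` are equal. -/
theorem IsInducedByWedge.eq {θ θ' : OneForm K (SmoothFun I M K)} (g : SmoothFun I M K)
    (hg : ∀ X ∈ F.E, θ' X = θ X + X g) {r : ℕ}
    {T T' : F.Cohomology nab r →ₗ[K] F.Cohomology nab (r + 1)}
    (hT : F.IsInducedByWedge nab r θ T) (hT' : F.IsInducedByWedge nab r θ' T') : T = T' := by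
  refine LinearMap.ext fun x => ?_
  obtain ⟨c, rfl⟩ := Submodule.Quotient.mk_surjective _ x
  obtain ⟨h, hTc⟩ := hT c
  obtain ⟨h', hTc'⟩ := hT' c
  rw [hTc, hTc', eq_comm, Submodule.Quotient.eq]
  exact wedge_sub_mem_coboundaries nab g hg c.2

end Local

end Foliation

end Geometry

/-! ### The lemma -/

theorem lemma2p1 {EM HM : Type*} [NormedAddCommGroup EM] [NormedSpace ℝ EM]
    [FiniteDimensional ℝ EM] [TopologicalSpace HM] (I : ModelWithCorners ℝ EM HM)
    (M : Type*) [TopologicalSpace M] [ChartedSpace HM M] [IsManifold I ∞ M]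
    [BoundarylessManifold I M] [T2Space M] [ParacompactSpace M]
    (K : Type*) [RCLike K] (p q : ℕ) (F : Foliation I M K p q)
    (nab : Connection K (SmoothFun I M K) F.Normal) (hnab : F.IsBott nab) (r : ℕ) :
    (∀ (e : F.Trivialization) (D : Connection K (SmoothFun I M K) F.Anticanonical),
      F.IsBottAnticanonical D →
      ∃! T : F.Cohomology nab r →ₗ[K] F.Cohomology nab (r + 1),
        F.IsInducedByWedge nab r (F.connectionForm e D) T) ∧
    (∀ (e e' : F.Trivialization) (D D' : Connection K (SmoothFun I M K) F.Anticanonical),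
      F.IsBottAnticanonical D → F.IsBottAnticanonical D' → e.Homotopic e' →
      ∀ T T' : F.Cohomology nab r →ₗ[K] F.Cohomology nab (r + 1),
        F.IsInducedByWedge nab r (F.connectionForm e D) T →
        F.IsInducedByWedge nab r (F.connectionForm e' D') T' → T = T') := by
  -- Uniqueness is the comparison of induced maps with $\theta'=\theta$ and $g=0$.
  have unique : ∀ (θ : OneForm K (SmoothFun I M K))
      (T T' : F.Cohomology nab r →ₗ[K] F.Cohomology nab (r + 1)),
      F.IsInducedByWedge nab r θ T → F.IsInducedByWedge nab r θ T' → T = T' :=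
    fun θ T T' hT hT' => Foliation.IsInducedByWedge.eq nab 0 (by simp) hT hT'
  refine ⟨fun e D hD => ?_, fun e e' D D' hD hD' hom T T' hT hT' => ?_⟩
  · obtain ⟨T, hT⟩ :=
      Foliation.exists_isInducedByWedge nab (Foliation.connectionForm_closed e hD) r
    exact ⟨T, hT, fun T' hT' => unique _ _ _ hT' hT⟩
  · obtain ⟨g, hg⟩ := Foliation.connectionForm_homotopic hD hD' hom
    exact Foliation.IsInducedByWedge.eq nab g hg hT hT'
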